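/- Let $F_n$ be the free group of rank $n$. Let $T$ and $T'$ be points of the closed unprojectivised Outer space $\overline{cv}_n$, i.e. $\mathbb{R}$-trees with very small isometric actions of $F_n$ (the action is minimal, setwise stabilizers of non-degenerate arcs are trivial or maximal cyclic, and stabilizers of tripods are trivial), and suppose that both actions have dense orbits. Write $\hat T = \overline{T} \cup \partial T$, where $\overline T$ is the metric completion and $\partial T$ the Gromov boundary of $T$. Give $\hat T$ the topology that extends the metric topology of $\overline T$ and in which a neighbourhood basis at a point of $\partial T$ is given by the components of complements of points of $T$ that contain the end of a ray representing it; for $p \neq q$ in $\hat T$, the direction of $q$ at $p$ is the component of $\hat T \setminus \{p\}$ containing $q$ for this topology. The observers' topology on $\hat T$ is the topology having the directions as a subbasis. Let $f : T \to T'$ be an $F_n$-equivariant bijection whose restriction to every segment $[x,y] \subseteq T$ is continuous (for the metric topologies). Then there is a unique homeomorphism $\hat f : \hat T \to \hat T'$, for the observers' topologies, that extends $f$. Moreover the dual laminations agree: $L^2(T) = L^2(T')$. Here $L^2(T) = \{(X,Y) \in \partial F_n \times \partial F_n : X \neq Y,\ Q(X) = Q(Y)\}$, where $Q(X)$ is the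 unique point of $\hat T$ that lies in the closure (for the extended metric topology) of $\varphi(\rho)$ for every free minimal simplicial metric $F_n$-tree $T_0$ (a point of $cv_n$), every $F_n$-equivariant map $\varphi : T_0 \to T$ that is isometric on edges, and every ray $\rho$ of $T_0$ representing $X$. -/

import Mathlib

open Set Filter Topology
open scoped NNReal Pointwise

universe u v

noncomputable section

/-! ### Real trees -/

/-- The segment between two points of a metric space: the points `z` lying metrically between them.
In an `ℝ`-tree this is the unique arc from `x` to `y`. -/
def treeSeg {T : Type u} [MetricSpace T] (x y : T) : Set T :=
  {z | dist x z + dist z y = dist x y}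

/-- `T` is an `ℝ`-tree: any two points `x`, `y` are joined by an isometric copy of the interval
`[0, d(x, y)]`, and every topological arc from `x` to `y` has the same image, namely the segment
from `x` to `y`. -/
structure IsRTree (T : Type u) [MetricSpace T] : Prop where
  exists_geodesic : ∀ x y : T, ∃ γ : ℝ → T, γ 0 = x ∧ γ (dist x y) = y ∧
    ∀ s ∈ Icc (0 : ℝ) (dist x y), ∀ t ∈ Icc (0 : ℝ) (dist x y), dist (γ s) (γ t) = |s - t|
  unique_arc : ∀ (x y : T) (p : unitInterval → T), Continuous p → Function.Injective p →
    p 0 = x → p 1 = y → range p = treeSeg x y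

/-- The map `f` is continuous on segments. -/
def ContinuousOnSegments {T : Type u} {T' : Type v} [MetricSpace T] [MetricSpace T']
    (f : T → T') : Prop :=
  ∀ x y : T, ContinuousOn f (treeSeg x y)

/-! ### Actions on trees, very small actions -/

section Actions

variable (G : Type v) [Group G] (T : Type u) [MetricSpace T] [MulAction G T]

variable {G} in
/-- The translation length `l_T(g) = inf_x d(x, g x)`. -/
def treeTranslationLength (g : G) : ℝ := ⨅ x : T, dist x (g • x)

/-- The action is minimal: `T` is the union of the axes of the hyperbolic elements, the axis of a
hyperbolic element `h` being the `h`-invariant isometric copy of `ℝ` in `T`. -/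
def IsMinimalTreeAction : Prop :=
  ∀ x : T, ∃ h : G, 0 < treeTranslationLength T h ∧
    ∃ γ : ℝ → T, Isometry γ ∧ h • range γ = range γ ∧ x ∈ range γ

/-- The action has dense orbits: the orbit of some point is dense. -/
def HasDenseOrbits : Prop := ∃ x : T, Dense (MulAction.orbit G x)

variable {G} in
/-- A maximal cyclic subgroup. -/
def IsMaximalCyclic (H : Subgroup G) : Prop :=
  IsCyclic H ∧ ∀ K : Subgroup G, IsCyclic K → H ≤ K → K = H

/-- Very small actions: minimal, setwise stabilizers of non-degenerate arcs are trivial or maximal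
cyclic, and stabilizers of tripods are trivial. -/
structure IsVerySmall : Prop where
  minimal : IsMinimalTreeAction G T
  arc : ∀ x y : T, x ≠ y →
    MulAction.stabilizer G (treeSeg x y) = ⊥ ∨
      IsMaximalCyclic (MulAction.stabilizer G (treeSeg x y))
  tripod : ∀ x y z : T, x ∉ treeSeg y z → y ∉ treeSeg x z → z ∉ treeSeg x y →
    MulAction.stabilizer G (treeSeg x y ∪ treeSeg y z ∪ treeSeg x z) = ⊥

end Actions

/-- `T` is a point of the closed unprojectivised Outer space of rank `n`: an `ℝ`-tree with a very
small isometric action of the free group of rank `n`. -/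
structure IsClosedOuterSpaceTree (n : ℕ) (T : Type u) [MetricSpace T]
    [MulAction (FreeGroup (Fin n)) T] : Prop where
  isRTree : IsRTree T
  isometric : ∀ (g : FreeGroup (Fin n)) (x y : T), dist (g • x) (g • y) = dist x y
  verySmall : IsVerySmall (FreeGroup (Fin n)) T

/-! ### The space `T̂ = T̄ ∪ ∂T` -/

/-- Geodesic rays. -/
def TreeRay (T : Type u) [MetricSpace T] : Type u := {ρ : ℝ≥0 → T // Isometry ρ}

/-- Two geodesic rays are asymptotic if they stay at bounded distance. -/
def treeRaySetoid (T : Type u) [MetricSpace T] : Setoid (TreeRay T) where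
  r ρ σ := ∃ C : ℝ, ∀ t, dist (ρ.1 t) (σ.1 t) ≤ C
  iseqv :=
    { refl := fun ρ => ⟨0, fun t => by simp⟩
      symm := fun ⟨C, h⟩ => ⟨C, fun t => by rw [dist_comm]; exact h t⟩
      trans := fun ⟨C, h⟩ ⟨D, k⟩ =>
        ⟨C + D, fun t => (dist_triangle _ _ _).trans (add_le_add (h t) (k t))⟩ }

/-- The Gromov boundary `∂T` of the tree `T`: asymptoty classes of geodesic rays. -/
def TreeBoundary (T : Type u) [MetricSpace T] : Type u := Quotient (treeRaySetoid T)

/-- The set `T̂ = T̄ ∪ ∂T`, where `T̄` is the metric completion and `∂T` the Gromov boundary. -/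
inductive HatTree (T : Type u) [MetricSpace T] : Type u
  | ofCompletion (p : UniformSpace.Completion T) : HatTree T
  | ofBoundary (e : TreeBoundary T) : HatTree T

namespace HatTree

variable (T : Type u) [MetricSpace T]

variable {T} in
/-- The inclusion of `T` in `T̂`. -/
def ofTree (x : T) : HatTree T := ofCompletion (x : UniformSpace.Completion T)

variable {T} in
/-- A subset `C` of `T̄` together with the boundary points represented by rays that eventually stay
in `C`. -/
def hull (C : Set (UniformSpace.Completion T)) : Set (HatTree T) :=
  ofCompletion '' C ∪ ofBoundary '' {e | ∃ ρ : TreeRay T, Quotient.mk (treeRaySetoid T) ρ = e ∧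
    ∀ᶠ t in atTop, (ρ.1 t : UniformSpace.Completion T) ∈ C}

/-- The extension of the metric topology of `T̄` to `T̂`: open subsets of `T̄` are open, and the
neighbourhoods of a boundary point are given by the components of the complements of points of `T`
that contain the end of a representing ray. -/
@[reducible] def metricTopology : TopologicalSpace (HatTree T) :=
  TopologicalSpace.generateFrom
    ({s | ∃ U : Set (UniformSpace.Completion T), IsOpen U ∧ s = ofCompletion '' U} ∪
      {s | ∃ (x : T) (y : UniformSpace.Completion T),
        s = hull (connectedComponentIn {(x : UniformSpace.Completion T)}ᶜ y)})

variable {T} in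
/-- The direction `d_p(q)` of `q` at `p`: the component of `T̂ ∖ {p}` containing `q`. -/
def direction (p q : HatTree T) : Set (HatTree T) :=
  @connectedComponentIn (HatTree T) (metricTopology T) {p}ᶜ q

/-- The observers' topology on `T̂`: the topology with the directions as a subbasis. As a
topological space, `HatTree T` always carries this topology. -/
instance observersTopology : TopologicalSpace (HatTree T) :=
  TopologicalSpace.generateFrom {s | ∃ p q : HatTree T, p ≠ q ∧ s = direction p q}

end HatTree

/-! ### The boundary of the free group -/

/-- The boundary `∂F_n` of the free group: infinite reduced words in the standard basis, that is,
geodesic rays issuing from `1` in the Cayley graph. A letter `(a, true)` is the generator `a`, a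
letter `(a, false)` its inverse. -/
@[ext]
structure FreeBoundary (n : ℕ) where
  letter : ℕ → Fin n × Bool
  reduced : ∀ i, (letter i).1 = (letter (i + 1)).1 → (letter i).2 = (letter (i + 1)).2

/-- The prefix of length `i` of an infinite reduced word, as an element of the free group. -/
def FreeBoundary.pre {n : ℕ} (X : FreeBoundary n) (i : ℕ) : FreeGroup (Fin n) :=
  FreeGroup.mk ((List.range i).map X.letter)

/-! ### Points of unprojectivised Outer space -/

/-- A point `T_0` of the unprojectivised Outer space `cv_n`: a simplicial tree with positive edge
lengths and a free minimal action of the free group of rank `n` preserving both. (An action on a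
tree without vertices fixed by non-trivial elements is free as `F_n` has no torsion.) -/
structure OuterSpaceTree (n : ℕ) where
  V : Type
  action : MulAction (FreeGroup (Fin n)) V
  graph : SimpleGraph V
  isTree : graph.IsTree
  smul_adj : ∀ (g : FreeGroup (Fin n)) (a b : V), graph.Adj a b → graph.Adj (g • a) (g • b)
  free : ∀ (g : FreeGroup (Fin n)) (a : V), g • a = a → g = 1
  minimal : ∀ S : Set V, S.Nonempty → (∀ (g : FreeGroup (Fin n)), ∀ a ∈ S, g • a ∈ S) →
    (graph.induce S).Connected → S = univ
  len : V → V → ℝ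
  len_pos : ∀ a b, graph.Adj a b → 0 < len a b
  len_comm : ∀ a b, len a b = len b a
  len_smul : ∀ (g : FreeGroup (Fin n)) (a b : V), len (g • a) (g • b) = len a b

attribute [instance] OuterSpaceTree.action

namespace OuterSpaceTree

variable {n : ℕ} (T₀ : OuterSpaceTree n)

/-- `ρ` is a ray of `T_0`, given by its successive vertices. -/
def IsRay (ρ : ℕ → T₀.V) : Prop :=
  Function.Injective ρ ∧ ∀ i, T₀.graph.Adj (ρ i) (ρ (i + 1))

/-- The ray `ρ` of `T_0` represents `X ∈ ∂F_n` under the identification `∂T_0 = ∂F_n` induced by the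
orbit maps: the orbit of a vertex along the prefixes of `X` stays at bounded distance from `ρ`. -/
def Represents (ρ : ℕ → T₀.V) (X : FreeBoundary n) : Prop :=
  ∃ (a : T₀.V) (C : ℕ), ∀ i, ∃ j, T₀.graph.dist (X.pre i • a) (ρ j) ≤ C

variable (T : Type u) [MetricSpace T] [MulAction (FreeGroup (Fin n)) T]

/-- An equivariant map `f : T_0 → T` that is isometric on edges. It is given by its values on
vertices: it maps an edge `[a, b]` isometrically onto the segment `[f(a), f(b)]`, whose length is the
length of the edge. -/
structure EdgeIsometry where
  toFun : T₀.V → T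
  map_smul : ∀ (g : FreeGroup (Fin n)) (a : T₀.V), toFun (g • a) = g • toFun a
  dist_eq : ∀ a b, T₀.graph.Adj a b → dist (toFun a) (toFun b) = T₀.len a b

variable {T₀ T} in
/-- The image of `f ∘ ρ`. -/
def EdgeIsometry.rayImage (f : T₀.EdgeIsometry T) (ρ : ℕ → T₀.V) : Set T :=
  ⋃ i : ℕ, treeSeg (f.toFun (ρ i)) (f.toFun (ρ (i + 1)))

end OuterSpaceTree

/-! ### The map `Q` and the dual lamination -/

section Lamination

variable {n : ℕ} (T : Type u) [MetricSpace T] [MulAction (FreeGroup (Fin n)) T]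

variable {T} in
/-- The point `P` of `T̂` lies in the closure of the image of `f ∘ ρ` for all equivariant maps
`f : T_0 → T` that are isometric on edges, with `T_0` in `cv_n`, and all rays `ρ` in `T_0`
representing `X`. -/
def IsQCandidate (X : FreeBoundary n) (P : HatTree T) : Prop :=
  ∀ (T₀ : OuterSpaceTree n) (f : T₀.EdgeIsometry T) (ρ : ℕ → T₀.V),
    T₀.IsRay ρ → T₀.Represents ρ X →
      P ∈ @closure (HatTree T) (HatTree.metricTopology T) (HatTree.ofTree '' f.rayImage ρ)

variable {T} in
/-- `Q(X) = P`: the point `P` is the unique point of `T̂` lying in the closure of the image of `f ∘ ρ`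
for all `f` and `ρ`. It is a point of `T̄` if these images are bounded (`X` is `T`-bounded), and the
boundary point that they converge to otherwise. -/
def IsQ (X : FreeBoundary n) (P : HatTree T) : Prop :=
  IsQCandidate X P ∧ ∀ P' : HatTree T, IsQCandidate X P' → P' = P

variable (n) in
/-- The dual lamination `L²(T) = {(X, Y) ∈ ∂²F_n | Q(X) = Q(Y)}`. -/
def dualLamination : Set (FreeBoundary n × FreeBoundary n) :=
  {p | p.1 ≠ p.2 ∧ ∃ P : HatTree T, IsQ p.1 P ∧ IsQ p.2 P}

end Lamination

end

/-! ### Directions and the four point condition -/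

section Metric

variable {X : Type u} [MetricSpace X]

/-- The points `x` and `y` lie in the same direction at `p`, that is, `p` does not lie metrically
between them. -/
def SameDir (p x y : X) : Prop := dist x y < dist x p + dist p y

/-- The four point condition, that is, `0`-hyperbolicity. -/
def FourPoint (X : Type u) [MetricSpace X] : Prop :=
  ∀ a b c d : X, dist a c + dist b d ≤ max (dist a b + dist c d) (dist b c + dist a d)

theorem mem_treeSeg {x y z : X} : z ∈ treeSeg x y ↔ dist x z + dist z y = dist x y := Iff.rfl

theorem notMem_treeSeg_iff {p x y : X} : p ∉ treeSeg x y ↔ SameDir p x y := by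
  rw [mem_treeSeg, SameDir, lt_iff_le_and_ne]
  exact ⟨fun h => ⟨dist_triangle _ _ _, fun h' => h h'.symm⟩, fun h h' => h.2 h'.symm⟩

theorem not_sameDir_iff {p x y : X} : ¬ SameDir p x y ↔ p ∈ treeSeg x y := by
  rw [← notMem_treeSeg_iff, not_not]

theorem SameDir.symm {p x y : X} (h : SameDir p x y) : SameDir p y x := by
  unfold SameDir at *
  rw [dist_comm y x, dist_comm y p, dist_comm p x]
  linarith

theorem SameDir.ne {p x y : X} (h : SameDir p x y) : x ≠ p := by
  rintro rfl
  simp [SameDir] at h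

theorem SameDir.refl {p x : X} (h : x ≠ p) : SameDir p x x := by
  have := dist_pos.2 h
  have := dist_pos.2 h.symm
  simp only [SameDir, dist_self]
  linarith

theorem sameDir_of_dist_lt {p x y : X} (h : dist x y < dist p y) : SameDir p x y := by
  unfold SameDir
  linarith [dist_nonneg (x := x) (y := p)]

theorem SameDir.trans (hX : FourPoint X) {p x y z : X} (h : SameDir p x y) (h' : SameDir p y z) :
    SameDir p x z := by
  unfold SameDir at *
  have := hX x y z p
  rw [dist_comm p y] at h
  rw [dist_comm p z] at h' ⊢
  rcases le_max_iff.1 this with h1 | h1 <;> linarith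

theorem isOpen_setOf_sameDir (p x : X) : IsOpen {y | SameDir p x y} :=
  isOpen_lt (by fun_prop) (by fun_prop)

theorem isOpen_setOf_not_sameDir (hX : FourPoint X) (p x : X) :
    IsOpen {y | y ≠ p ∧ ¬ SameDir p x y} := by
  rw [isOpen_iff_mem_nhds]
  rintro y ⟨hy, hxy⟩
  filter_upwards [(isOpen_setOf_sameDir p y).mem_nhds (SameDir.refl hy)] with z hz
  exact ⟨hz.symm.ne, fun h => hxy (h.trans hX (SameDir.symm hz))⟩

theorem left_mem_treeSeg (x y : X) : x ∈ treeSeg x y := by simp [treeSeg]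

theorem right_mem_treeSeg (x y : X) : y ∈ treeSeg x y := by simp [treeSeg]

theorem treeSeg_comm (x y : X) : treeSeg x y = treeSeg y x := by
  ext z
  simp only [mem_treeSeg]
  rw [dist_comm x z, dist_comm z y, dist_comm x y, add_comm]

theorem treeSeg_self (x : X) : treeSeg x x = {x} := by
  ext z
  simp only [mem_treeSeg, dist_self, mem_singleton_iff]
  constructor
  · intro h
    rw [dist_comm x z] at h
    exact dist_eq_zero.1 (by linarith)
  · rintro rfl
    simp

theorem mem_treeSeg_trans {x y z w : X} (hz : z ∈ treeSeg x y) (hw : w ∈ treeSeg x z) :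
    w ∈ treeSeg x y := by
  simp only [mem_treeSeg] at *
  linarith [dist_triangle w z y, dist_triangle x w y]

theorem isClosed_treeSeg (x y : X) : IsClosed (treeSeg x y) :=
  isClosed_eq (by fun_prop) (by fun_prop)

theorem FourPoint.completion (hX : FourPoint X) : FourPoint (UniformSpace.Completion X) := by
  have h : ∀ (a b : X) (c d : UniformSpace.Completion X),
      dist (a : UniformSpace.Completion X) c + dist (b : UniformSpace.Completion X) d ≤
        max (dist (a : UniformSpace.Completion X) b + dist c d) (dist ↑b c + dist ↑a d) := by
    intro a b c d
    induction c, d using UniformSpace.Completion.induction_on₂ with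
    | hp => exact isClosed_le (by fun_prop) (by fun_prop)
    | ih c d =>
      simp only [UniformSpace.Completion.dist_eq]
      exact hX a b c d
  intro a b c d
  induction a, b using UniformSpace.Completion.induction_on₂ with
  | hp => exact isClosed_le (by fun_prop) (by fun_prop)
  | ih a b => exact h a b c d

end Metric

/-! ### Segments, medians and connectedness in `ℝ`-trees -/

namespace IsRTree

variable {T : Type u} [MetricSpace T]

theorem image_Icc_eq_treeSeg (hT : IsRTree T) {L : ℝ} (hL : 0 < L) {q : ℝ → T}
    (hq : ContinuousOn q (Icc 0 L)) (hinj : InjOn q (Icc 0 L)) :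
    q '' Icc 0 L = treeSeg (q 0) (q L) := by
  have hmem : ∀ s : unitInterval, L * (s : ℝ) ∈ Icc (0 : ℝ) L := fun s =>
    ⟨mul_nonneg hL.le s.2.1, mul_le_of_le_one_right hL.le s.2.2⟩
  rw [← hT.unique_arc (q 0) (q L) (fun s => q (L * s)) _ _ (by simp) (by simp)]
  · ext z
    constructor
    · rintro ⟨t, ht, rfl⟩
      refine ⟨⟨t / L, div_nonneg ht.1 hL.le, (div_le_one hL).2 ht.2⟩, ?_⟩
      simp only
      rw [mul_div_cancel₀ _ hL.ne']
    · rintro ⟨s, rfl⟩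
      exact ⟨_, hmem s, rfl⟩
  · exact hq.comp_continuous (by fun_prop) hmem
  · intro s t h
    have := hinj (hmem s) (hmem t) h
    exact Subtype.ext (mul_left_cancel₀ hL.ne' this)

theorem exists_geodesic_treeSeg (hT : IsRTree T) (x y : T) : ∃ γ : ℝ → T, Continuous γ ∧
    InjOn γ (Icc 0 (dist x y)) ∧
    (∀ z ∈ treeSeg x y, γ (dist x z) = z) ∧
    (∀ t ∈ Icc 0 (dist x y), γ t ∈ treeSeg x y ∧ dist x (γ t) = t) ∧
    ∀ s ∈ Icc 0 (dist x y), ∀ t ∈ Icc 0 (dist x y), dist (γ s) (γ t) = |s - t| := by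
  obtain ⟨γ, h0, h1, hγ⟩ := hT.exists_geodesic x y
  set d := dist x y with hd
  have hd0 : 0 ≤ d := dist_nonneg
  have hinj : InjOn γ (Icc 0 d) := by
    intro s hs t ht h
    have := hγ s hs t ht
    rw [h, dist_self] at this
    linarith [abs_eq_zero.1 this.symm]
  have hcont : ContinuousOn γ (Icc 0 d) := by
    have : LipschitzOnWith 1 γ (Icc 0 d) :=
      LipschitzOnWith.of_dist_le_mul fun s hs t ht => by
        rw [hγ s hs t ht, Real.dist_eq]; simp
    exact this.continuousOn
  have hx : ∀ t ∈ Icc 0 d, dist x (γ t) = t := fun t ht => by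
    have := hγ 0 ⟨le_rfl, hd0⟩ t ht
    rw [h0] at this
    rw [this, zero_sub, abs_neg, abs_of_nonneg ht.1]
  have hseg : ∀ t ∈ Icc 0 d, γ t ∈ treeSeg x y := fun t ht => by
    have := hγ t ht d ⟨hd0, le_rfl⟩
    rw [h1, abs_sub_comm, abs_of_nonneg (by linarith [ht.2])] at this
    simp only [mem_treeSeg]
    rw [this, hx t ht]
    linarith
  have hz : ∀ z ∈ treeSeg x y, γ (dist x z) = z := by
    intro z hz
    rcases hd0.eq_or_lt with h | h
    · have hxy : x = y := dist_eq_zero.1 (hd ▸ h.symm)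
      subst hxy
      rw [treeSeg_self] at hz
      rw [mem_singleton_iff.1 hz, dist_self, h0]
    · have him := hT.image_Icc_eq_treeSeg h hcont hinj
      rw [h0, h1] at him
      rw [← him] at hz
      obtain ⟨t, ht, rfl⟩ := hz
      rw [hx t ht]
  have hpr : ∀ t ∈ Icc 0 d, (projIcc 0 d hd0 t : ℝ) = t := fun t ht => by
    rw [projIcc_of_mem hd0 ht]
  have hzmem : ∀ z ∈ treeSeg x y, dist x z ∈ Icc 0 d := fun z hz => by
    refine ⟨dist_nonneg, ?_⟩
    simp only [mem_treeSeg] at hz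
    linarith [dist_nonneg (x := z) (y := y)]
  refine ⟨fun t => γ (projIcc 0 d hd0 t), ?_, ?_, ?_, ?_, ?_⟩
  · exact hcont.comp_continuous (by fun_prop) fun t => (projIcc 0 d hd0 t).2
  · intro s hs t ht h
    simp only [hpr s hs, hpr t ht] at h
    exact hinj hs ht h
  · intro z hz'
    simp only [hpr _ (hzmem z hz')]
    exact hz z hz'
  · intro t ht
    simp only [hpr t ht]
    exact ⟨hseg t ht, hx t ht⟩
  · intro s hs t ht
    simp only [hpr s hs, hpr t ht]
    exact hγ s hs t ht

theorem exists_mem_treeSeg (hT : IsRTree T) {x y : T} {t : ℝ} (h0 : 0 ≤ t) (h1 : t ≤ dist x y) :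
    ∃ z ∈ treeSeg x y, dist x z = t := by
  obtain ⟨γ, -, -, -, h, -⟩ := hT.exists_geodesic_treeSeg x y
  exact ⟨γ t, h t ⟨h0, h1⟩⟩

theorem dist_le_of_mem {x y z : T} (hz : z ∈ treeSeg x y) : dist x z ≤ dist x y := by
  simp only [mem_treeSeg] at hz
  linarith [dist_nonneg (x := z) (y := y)]

theorem dist_of_mem_treeSeg (hT : IsRTree T) {x y z w : T} (hz : z ∈ treeSeg x y)
    (hw : w ∈ treeSeg x y) : dist z w = |dist x z - dist x w| := by
  obtain ⟨γ, -, -, h1, -, h⟩ := hT.exists_geodesic_treeSeg x y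
  have := h _ ⟨dist_nonneg, dist_le_of_mem hz⟩ _ ⟨dist_nonneg, dist_le_of_mem hw⟩
  rwa [h1 z hz, h1 w hw] at this

theorem eq_of_mem_treeSeg (hT : IsRTree T) {x y z w : T} (hz : z ∈ treeSeg x y)
    (hw : w ∈ treeSeg x y) (h : dist x z = dist x w) : z = w := by
  have := hT.dist_of_mem_treeSeg hz hw
  rw [h, sub_self, abs_zero] at this
  exact dist_eq_zero.1 this

theorem mem_treeSeg_of_dist_le (hT : IsRTree T) {x y z w : T} (hz : z ∈ treeSeg x y)
    (hw : w ∈ treeSeg x y) (h : dist x z ≤ dist x w) : z ∈ treeSeg x w := by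
  have := hT.dist_of_mem_treeSeg hz hw
  rw [abs_of_nonpos (by linarith)] at this
  simp only [mem_treeSeg]
  linarith

theorem image_geodesic {x y : T} {γ : ℝ → T} (h1 : ∀ z ∈ treeSeg x y, γ (dist x z) = z)
    (h2 : ∀ t ∈ Icc 0 (dist x y), γ t ∈ treeSeg x y ∧ dist x (γ t) = t) :
    γ '' Icc 0 (dist x y) = treeSeg x y := by
  ext z
  constructor
  · rintro ⟨t, ht, rfl⟩
    exact (h2 t ht).1
  · exact fun hz => ⟨_, ⟨dist_nonneg, dist_le_of_mem hz⟩, h1 z hz⟩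

theorem isCompact_treeSeg (hT : IsRTree T) (x y : T) : IsCompact (treeSeg x y) := by
  obtain ⟨γ, hγ, -, h1, h2, -⟩ := hT.exists_geodesic_treeSeg x y
  rw [← image_geodesic h1 h2]
  exact isCompact_Icc.image hγ

theorem isPreconnected_treeSeg (hT : IsRTree T) (x y : T) : IsPreconnected (treeSeg x y) := by
  obtain ⟨γ, hγ, -, h1, h2, -⟩ := hT.exists_geodesic_treeSeg x y
  rw [← image_geodesic h1 h2]
  exact isPreconnected_Icc.image _ hγ.continuousOn

theorem exists_median (hT : IsRTree T) (x y z : T) :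
    ∃ m, m ∈ treeSeg x y ∧ m ∈ treeSeg x z ∧ m ∈ treeSeg y z := by
  obtain ⟨γ, hγ, γinj, γ1, γ2, -⟩ := hT.exists_geodesic_treeSeg x y
  obtain ⟨δ, hδ, δinj, δ1, δ2, -⟩ := hT.exists_geodesic_treeSeg x z
  have hK : IsCompact (Icc 0 (dist x y) ∩ γ ⁻¹' treeSeg x z) :=
    isCompact_Icc.inter_right ((isClosed_treeSeg x z).preimage hγ)
  have h0 : γ 0 = x := by simpa using γ1 x (left_mem_treeSeg x y)
  have hd : γ (dist x y) = y := γ1 y (right_mem_treeSeg x y)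
  have hdz : δ (dist x z) = z := δ1 z (right_mem_treeSeg x z)
  obtain ⟨t, ⟨⟨ht, htz⟩, hmax⟩⟩ := hK.exists_isGreatest
    ⟨0, ⟨le_rfl, dist_nonneg⟩, by simpa [h0] using left_mem_treeSeg x z⟩
  have hmy := (γ2 t ht).1
  have hxm := (γ2 t ht).2
  refine ⟨γ t, hmy, htz, ?_⟩
  have htz' : t ≤ dist x z := by rw [← hxm]; exact dist_le_of_mem htz
  have hδt : δ t = γ t := by rw [← δ1 _ htz, hxm]
  rcases ht.2.eq_or_lt with h | hlt
  · rw [h, hd]; exact left_mem_treeSeg y z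
  set d := dist x y with hd_def
  set q : ℝ → T := fun s => if s ≤ d - t then γ (d - s) else δ (t + (s - (d - t))) with hq
  have hqc : Continuous q :=
    Continuous.if_le (by fun_prop) (by fun_prop) continuous_id continuous_const (by
      rintro s rfl; simp [hδt])
  set L := (d - t) + (dist x z - t) with hL
  have hinj : InjOn q (Icc 0 L) := by
    have key : ∀ s ∈ Icc 0 L, ∀ s' ∈ Icc 0 L, s ≤ d - t → d - t < s' → q s ≠ q s' := by
      intro s hs s' hs' h h' heq
      have m1 : d - s ∈ Icc 0 d := ⟨by linarith [ht.1], by linarith [hs.1]⟩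
      have m2 : t + (s' - (d - t)) ∈ Icc 0 (dist x z) :=
        ⟨by linarith [ht.1], by linarith [hs'.2]⟩
      simp only [hq, if_pos h, if_neg (not_le.2 h')] at heq
      have hle := hmax ⟨m1, by rw [mem_preimage, heq]; exact (δ2 _ m2).1⟩
      have hs_eq : d - s = t := by linarith
      rw [hs_eq, ← hδt] at heq
      have := δinj ⟨ht.1, htz'⟩ m2 heq
      linarith
    intro s hs s' hs' heq
    by_cases h : s ≤ d - t <;> by_cases h' : s' ≤ d - t
    · simp only [hq, if_pos h, if_pos h'] at heq
      have := γinj ⟨by linarith [ht.1], by linarith [hs.1]⟩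
        ⟨by linarith [ht.1], by linarith [hs'.1]⟩ heq
      linarith
    · exact absurd heq (key s hs s' hs' h (not_le.1 h'))
    · exact absurd heq.symm (key s' hs' s hs h' (not_le.1 h))
    · simp only [hq, if_neg h, if_neg h'] at heq
      have := δinj ⟨by linarith [ht.1], by linarith [hs.2]⟩
        ⟨by linarith [ht.1], by linarith [hs'.2]⟩ heq
      linarith
  have him := hT.image_Icc_eq_treeSeg (by linarith) hqc.continuousOn hinj
  have hq0 : q 0 = y := by simp [hq, hlt.le, hd]
  have hqL : q L = z := by
    rcases htz'.eq_or_lt with h | h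
    · have : L = d - t := by linarith
      simp only [hq, this, le_refl, if_true, sub_sub_cancel]
      rw [← hδt, h, hdz]
    · have h' : ¬ L ≤ d - t := by linarith
      simp only [hq, if_neg h']
      rw [show t + (L - (d - t)) = dist x z by simp only [hL]; ring, hdz]
  rw [hq0, hqL] at him
  rw [← him]
  refine ⟨d - t, ⟨by linarith, by linarith⟩, ?_⟩
  simp [hq]

theorem treeSeg_subset_union (hT : IsRTree T) (x y z : T) :
    treeSeg x z ⊆ treeSeg x y ∪ treeSeg y z := by
  intro p hp
  obtain ⟨m, h1, h2, h3⟩ := hT.exists_median x z y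
  rcases le_total (dist x p) (dist x m) with h | h
  · exact .inl (mem_treeSeg_trans h2 (hT.mem_treeSeg_of_dist_le hp h1 h))
  · right
    have h4 : p ∈ treeSeg m z := by
      have := hT.mem_treeSeg_of_dist_le h1 hp h
      simp only [mem_treeSeg] at this hp h1 ⊢
      linarith
    rw [treeSeg_comm] at h3 h4 ⊢
    rw [treeSeg_comm y z] at h3
    exact mem_treeSeg_trans h3 h4

theorem fourPoint (hT : IsRTree T) : FourPoint T := by
  intro a b c d
  obtain ⟨m, h1, h2, h3⟩ := hT.exists_median a b c
  simp only [mem_treeSeg] at h1 h3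
  rcases hT.treeSeg_subset_union a d c h2 with h | h <;>
    simp only [mem_treeSeg] at h h2
  · refine le_max_of_le_right ?_
    linarith [dist_triangle b m d]
  · refine le_max_of_le_left ?_
    linarith [dist_triangle b m d, dist_comm d m, dist_comm d c, dist_comm m b]

theorem isPreconnected_setOf_sameDir (hT : IsRTree T) (p x : T) :
    IsPreconnected {y | SameDir p x y} := by
  refine isPreconnected_of_forall_pair fun y hy z hz => ⟨treeSeg y z, ?_, left_mem_treeSeg y z,
    right_mem_treeSeg y z, hT.isPreconnected_treeSeg y z⟩
  intro w hw
  have hyz : SameDir p y z := (SameDir.symm hy).trans hT.fourPoint hz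
  refine SameDir.trans hT.fourPoint hy ?_
  by_contra h
  exact notMem_treeSeg_iff.2 hyz (mem_treeSeg_trans hw (not_sameDir_iff.1 h))

theorem preconnectedSpace (hT : IsRTree T) : PreconnectedSpace T :=
  ⟨isPreconnected_of_forall_pair fun y _ z _ => ⟨treeSeg y z, subset_univ _,
    left_mem_treeSeg y z, right_mem_treeSeg y z, hT.isPreconnected_treeSeg y z⟩⟩

end IsRTree

/-! ### Rays -/

namespace TreeRay

variable {T : Type u} [MetricSpace T]

theorem dist_eq (ρ : TreeRay T) (s t : ℝ≥0) : dist (ρ.1 s) (ρ.1 t) = |(s : ℝ) - t| := by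
  rw [ρ.2.dist_eq, NNReal.dist_eq]

theorem sub_le_dist (ρ : TreeRay T) (p : T) (t : ℝ≥0) : (t : ℝ) - dist p (ρ.1 0) ≤ dist (ρ.1 t) p := by
  have h := ρ.dist_eq t 0
  rw [NNReal.coe_zero, sub_zero, abs_of_nonneg (NNReal.coe_nonneg t)] at h
  linarith [dist_triangle (ρ.1 t) p (ρ.1 0)]

theorem eventually_lt_coe (C : ℝ) : ∀ᶠ t : ℝ≥0 in atTop, C < t :=
  NNReal.tendsto_coe_atTop.2 tendsto_id |>.eventually_gt_atTop C

theorem eventually_sameDir {ρ σ : TreeRay T} (h : (treeRaySetoid T).r ρ σ) (p : T) :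
    ∀ᶠ t in atTop, SameDir p (ρ.1 t) (σ.1 t) := by
  obtain ⟨C, hC⟩ := h
  filter_upwards [eventually_lt_coe (C + dist p (ρ.1 0)),
    eventually_lt_coe (dist p (σ.1 0))] with t h1 h2
  unfold SameDir
  have := hC t
  have := ρ.sub_le_dist p t
  have := σ.sub_le_dist p t
  rw [dist_comm p (σ.1 t)]
  linarith

theorem mem_treeSeg (ρ : TreeRay T) {s t r : ℝ≥0} (h : s ≤ t) (h' : t ≤ r) :
    ρ.1 t ∈ treeSeg (ρ.1 s) (ρ.1 r) := by
  have h1 : (s : ℝ) ≤ t := h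
  have h2 : (t : ℝ) ≤ r := h'
  rw [_root_.mem_treeSeg, ρ.dist_eq, ρ.dist_eq, ρ.dist_eq, abs_of_nonpos, abs_of_nonpos,
    abs_of_nonpos] <;> linarith

theorem mem_treeSeg_of_lt (hT : IsRTree T) (ρ : TreeRay T) {x : T} {t r : ℝ≥0}
    (h : dist (ρ.1 0) x < t) (h' : t ≤ r) : ρ.1 t ∈ treeSeg x (ρ.1 r) := by
  rcases hT.treeSeg_subset_union _ x _ (ρ.mem_treeSeg (zero_le : 0 ≤ t) h') with h1 | h1
  · have := IsRTree.dist_le_of_mem h1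
    rw [ρ.dist_eq, NNReal.coe_zero, zero_sub, abs_neg, abs_of_nonneg (NNReal.coe_nonneg t)] at this
    exact absurd h (not_lt.2 this)
  · exact h1

end TreeRay

namespace HatTree

variable {T : Type u} [MetricSpace T]

open UniformSpace

/-- The point `a` of `T̂` and the point `x` of `T` lie in the same direction at `p`. -/
def Near (p : T) : HatTree T → T → Prop
  | ofCompletion a, x => SameDir (p : Completion T) x a
  | ofBoundary e, x => ∃ ρ : TreeRay T, Quotient.mk (treeRaySetoid T) ρ = e ∧
      ∀ᶠ t in atTop, SameDir p x (ρ.1 t)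

theorem sameDir_coe {p x y : T} :
    SameDir (p : Completion T) x y ↔ SameDir p x y := by
  simp only [SameDir, Completion.dist_eq]

theorem near_ofTree {p x y : T} : Near p (ofTree y) x ↔ SameDir p x y := sameDir_coe

theorem ofTree_injective : Function.Injective (ofTree : T → HatTree T) := by
  intro x y h
  exact Completion.coe_injective T (ofCompletion.inj h)

theorem near_mk (hT : IsRTree T) {p x : T} {ρ : TreeRay T} :
    Near p (ofBoundary (Quotient.mk (treeRaySetoid T) ρ)) x ↔
      ∀ᶠ t in atTop, SameDir p x (ρ.1 t) := by
  constructor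
  · rintro ⟨σ, hσ, h⟩
    filter_upwards [h, TreeRay.eventually_sameDir (Quotient.exact hσ) p] with t h1 h2
    exact h1.trans hT.fourPoint h2
  · exact fun h => ⟨ρ, rfl, h⟩

theorem Near.sameDir (hT : IsRTree T) {p x y : T} {a : HatTree T} (hx : Near p a x)
    (hy : Near p a y) : SameDir p x y := by
  match a with
  | ofCompletion a =>
    exact sameDir_coe.1 (SameDir.trans hT.fourPoint.completion hx (SameDir.symm hy))
  | ofBoundary e =>
    induction e using Quotient.inductionOn with | h ρ =>
    obtain ⟨t, h1, h2⟩ := (((near_mk hT).1 hx).and ((near_mk hT).1 hy)).exists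
    exact h1.trans hT.fourPoint h2.symm

theorem Near.trans (hT : IsRTree T) {p x y : T} {a : HatTree T} (hx : Near p a x)
    (hxy : SameDir p x y) : Near p a y := by
  match a with
  | ofCompletion a =>
    exact SameDir.trans hT.fourPoint.completion (sameDir_coe.2 hxy.symm) hx
  | ofBoundary e =>
    obtain ⟨ρ, h, h'⟩ := hx
    exact ⟨ρ, h, h'.mono fun t ht => hxy.symm.trans hT.fourPoint ht⟩

theorem not_near_self {p x : T} : ¬ Near p (ofTree p) x := fun h => (near_ofTree.1 h).symm.ne rfl

theorem Near.ne {p x : T} {a : HatTree T} (h : Near p a x) : x ≠ p := by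
  match a with
  | ofCompletion a =>
    rintro rfl
    exact SameDir.ne h rfl
  | ofBoundary e =>
    obtain ⟨ρ, -, h'⟩ := h
    exact h'.exists.choose_spec.ne

theorem exists_dist_lt (a : Completion T) {ε : ℝ} (hε : 0 < ε) :
    ∃ x : T, dist (x : Completion T) a < ε := by
  obtain ⟨x, hx⟩ := Completion.denseRange_coe.exists_dist_lt a hε
  exact ⟨x, by rwa [dist_comm]⟩

theorem exists_near {p : T} {a : HatTree T} (h : a ≠ ofTree p) : ∃ x, Near p a x := by
  match a with
  | ofCompletion a =>
    have hpa : (p : Completion T) ≠ a := fun h' => h (by rw [ofTree, h'])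
    obtain ⟨x, hx⟩ := exists_dist_lt a (dist_pos.2 hpa)
    exact ⟨x, sameDir_of_dist_lt hx⟩
  | ofBoundary e =>
    induction e using Quotient.inductionOn with | h ρ =>
    obtain ⟨t, ht⟩ := (TreeRay.eventually_lt_coe (dist p (ρ.1 0))).exists
    refine ⟨ρ.1 t, ρ, rfl, ?_⟩
    filter_upwards [eventually_ge_atTop t] with s hs
    have h1 := ρ.sub_le_dist p t
    have h2 := ρ.sub_le_dist p s
    have h3 := ρ.dist_eq t s
    have h4 : (t : ℝ) ≤ s := hs
    rw [abs_of_nonpos (by linarith)] at h3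
    unfold SameDir
    rw [dist_comm p (ρ.1 s)]
    linarith

/-! ### The metric topology -/

theorem isPreconnected_setOf_sameDir_completion (hT : IsRTree T) (p : T) (y : Completion T) :
    IsPreconnected {r : Completion T | SameDir (p : Completion T) y r} := by
  rcases eq_or_ne y p with rfl | hy
  · convert isPreconnected_empty
    exact eq_empty_of_forall_notMem fun r hr => SameDir.ne hr rfl
  obtain ⟨x, hx⟩ := exists_dist_lt y (dist_pos.2 hy.symm)
  have hyx : SameDir (p : Completion T) y x := (sameDir_of_dist_lt hx).symm
  have h1 : IsPreconnected ((fun z : T => (z : Completion T)) '' {z | SameDir p x z}) :=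
    (hT.isPreconnected_setOf_sameDir p x).image _ (Completion.continuous_coe T).continuousOn
  refine h1.subset_closure ?_ ?_
  · rintro _ ⟨z, hz, rfl⟩
    exact hyx.trans hT.fourPoint.completion (sameDir_coe.2 hz)
  · intro r hr
    have := Completion.denseRange_coe (α := T) |>.open_subset_closure_inter
      (isOpen_setOf_sameDir (p : Completion T) y) hr
    refine closure_mono ?_ this
    rintro _ ⟨hz, ⟨z, rfl⟩⟩
    exact ⟨z, sameDir_coe.1 (hyx.symm.trans hT.fourPoint.completion hz), rfl⟩

theorem connectedComponentIn_compl (hT : IsRTree T) (p : T) (y : Completion T) :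
    connectedComponentIn {(p : Completion T)}ᶜ y = {r | SameDir (p : Completion T) y r} := by
  rcases eq_or_ne y p with rfl | hy
  · rw [connectedComponentIn_eq_empty (by simp)]
    exact (eq_empty_of_forall_notMem fun r hr => SameDir.ne hr rfl).symm
  apply Subset.antisymm
  · refine isPreconnected_connectedComponentIn.subset_left_of_subset_union
      (isOpen_setOf_sameDir (p : Completion T) y)
      (isOpen_setOf_not_sameDir hT.fourPoint.completion (p : Completion T) y) ?_ ?_ ?_
    · exact disjoint_left.2 fun r h h' => h'.2 h
    · intro r hr
      by_cases h : SameDir (p : Completion T) y r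
      · exact .inl h
      · exact .inr ⟨connectedComponentIn_subset _ _ hr, h⟩
    · exact ⟨y, mem_connectedComponentIn hy, SameDir.refl hy⟩
  · exact (isPreconnected_setOf_sameDir_completion hT p y).subset_connectedComponentIn
      (SameDir.refl hy) fun r hr => (SameDir.symm hr).ne

theorem hull_eq (p x : T) :
    hull {r : Completion T | SameDir (p : Completion T) x r} = {a | Near p a x} := by
  ext a
  match a with
  | ofCompletion a =>
    simp only [hull, mem_union, mem_image]
    constructor
    · rintro (⟨b, hb, h⟩ | ⟨b, hb, h⟩)
      · cases h; exact hb
      · cases h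
    · exact fun h => .inl ⟨a, h, rfl⟩
  | ofBoundary e =>
    simp only [hull, mem_union, mem_image]
    constructor
    · rintro (⟨b, hb, h⟩ | ⟨b, hb, h⟩)
      · cases h
      · cases h
        obtain ⟨ρ, h1, h2⟩ := hb
        exact ⟨ρ, h1, h2.mono fun t ht => sameDir_coe.1 ht⟩
    · rintro ⟨ρ, h1, h2⟩
      exact .inr ⟨e, ⟨ρ, h1, h2.mono fun t ht => sameDir_coe.2 ht⟩, rfl⟩

theorem hull_connectedComponentIn (hT : IsRTree T) {p x : T} {y : Completion T}
    (h : SameDir (p : Completion T) y x) :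
    hull (connectedComponentIn {(p : Completion T)}ᶜ y) = {a | Near p a x} := by
  rw [connectedComponentIn_compl hT, ← hull_eq]
  congr 1
  ext r
  exact ⟨fun hr => h.symm.trans hT.fourPoint.completion hr,
    fun hr => h.trans hT.fourPoint.completion hr⟩

theorem hull_empty : hull (∅ : Set (Completion T)) = ∅ := by
  refine eq_empty_of_forall_notMem ?_
  rintro _ (⟨b, hb, -⟩ | ⟨e, ⟨ρ, -, h⟩, -⟩)
  · exact hb
  · exact h.exists.choose_spec

theorem isOpen_setOf_near (hT : IsRTree T) (p x : T) :
    IsOpen[metricTopology T] {a | Near p a x} := by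
  rcases eq_or_ne x p with rfl | h
  · rw [eq_empty_of_forall_notMem (s := {a : HatTree T | Near x a x}) fun a ha => Near.ne ha rfl]
    exact @isOpen_empty _ (metricTopology T)
  · refine .basic _ (.inr ⟨p, x, ?_⟩)
    exact (hull_connectedComponentIn hT (sameDir_coe.2 (SameDir.refl h))).symm

/-- Convergence in `T̂`, for the extended metric topology, of a family of points of `T`. -/
def MetricTendsto {ι : Type*} (x : ι → T) (l : Filter ι) (a : HatTree T) : Prop :=
  Tendsto (fun i => ofTree (x i)) l (@nhds (HatTree T) (metricTopology T) a)

theorem metricTendsto_iff (hT : IsRTree T) {ι : Type*} {x : ι → T} {l : Filter ι} {a : HatTree T} :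
    MetricTendsto x l a ↔
      (∀ U : Set (Completion T), IsOpen U → a ∈ ofCompletion '' U →
        ∀ᶠ i in l, (x i : Completion T) ∈ U) ∧
      ∀ p y : T, Near p a y → ∀ᶠ i in l, SameDir p y (x i) := by
  rw [MetricTendsto, TopologicalSpace.tendsto_nhds_generateFrom_iff]
  constructor
  · intro h
    constructor
    · intro U hU ha
      filter_upwards [h _ (.inl ⟨U, hU, rfl⟩) ha] with i hi
      obtain ⟨z, hz, h'⟩ := hi
      cases h'
      exact hz
    · intro p y hy
      have : ∀ᶠ i in l, ofTree (x i) ∈ {a | Near p a y} := h _ (.inr ⟨p, y, (hull_connectedComponentIn hT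
        (sameDir_coe.2 (SameDir.refl hy.ne))).symm⟩) hy
      exact this.mono fun i hi => near_ofTree.1 hi
  · rintro ⟨h1, h2⟩ s (⟨U, hU, rfl⟩ | ⟨p, y, rfl⟩) ha
    · filter_upwards [h1 U hU ha] with i hi
      exact ⟨_, hi, rfl⟩
    · rcases eq_or_ne y p with rfl | hy
      · rw [connectedComponentIn_eq_empty (by simp), hull_empty] at ha
        exact ha.elim
      · obtain ⟨z, hz⟩ := exists_dist_lt y (dist_pos.2 hy.symm)
        have hs := hull_connectedComponentIn hT (sameDir_of_dist_lt hz).symm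
        rw [hs] at ha ⊢
        exact (h2 p z ha).mono fun i hi => near_ofTree.2 hi

theorem MetricTendsto.eventually (hT : IsRTree T) {ι : Type*} {x : ι → T} {l : Filter ι}
    {a : HatTree T} (h : MetricTendsto x l a) {p y : T} (hy : Near p a y) :
    ∀ᶠ i in l, SameDir p y (x i) :=
  ((metricTendsto_iff hT).1 h).2 p y hy

theorem metricTendsto_ofCompletion (hT : IsRTree T) {ι : Type*} {x : ι → T} {l : Filter ι}
    {a : Completion T} :
    MetricTendsto x l (ofCompletion a) ↔ Tendsto (fun i => (x i : Completion T)) l (𝓝 a) := by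
  rw [metricTendsto_iff hT]
  constructor
  · rintro ⟨h, -⟩ s hs
    obtain ⟨U, hU, hU', haU⟩ := _root_.mem_nhds_iff.1 hs
    exact (h U hU' ⟨a, haU, rfl⟩).mono fun i hi => hU hi
  · intro h
    constructor
    · rintro U hU ⟨b, hb, h'⟩
      cases h'
      exact h.eventually (hU.mem_nhds hb)
    · intro p y hy
      exact (h.eventually ((isOpen_setOf_sameDir (p : Completion T) y).mem_nhds hy)).mono
        fun i hi => sameDir_coe.1 hi

theorem metricTendsto_ofTree (hT : IsRTree T) {ι : Type*} {x : ι → T} {l : Filter ι} {a : T} :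
    MetricTendsto x l (ofTree a) ↔ Tendsto x l (𝓝 a) := by
  rw [ofTree, metricTendsto_ofCompletion hT]
  exact (Completion.isUniformEmbedding_coe T).isEmbedding.tendsto_nhds_iff.symm

theorem metricTendsto_ray (hT : IsRTree T) (ρ : TreeRay T) :
    MetricTendsto ρ.1 atTop (ofBoundary (Quotient.mk (treeRaySetoid T) ρ)) := by
  rw [metricTendsto_iff hT]
  constructor
  · rintro U hU ⟨b, hb, h'⟩
    cases h'
  · exact fun p y hy => (near_mk hT).1 hy

theorem continuous_ofTree (hT : IsRTree T) :
    @Continuous T (HatTree T) _ (metricTopology T) ofTree := by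
  let _ := metricTopology T
  exact continuous_iff_continuousAt.2 fun x => (metricTendsto_ofTree hT).2 tendsto_id

theorem exists_metricTendsto (hT : IsRTree T) (a : HatTree T) :
    ∃ l : Filter T, l.NeBot ∧ MetricTendsto id l a := by
  match a with
  | ofCompletion a =>
    refine ⟨comap (↑) (𝓝 a), (Completion.isDenseInducing_coe).comap_nhds_neBot a, ?_⟩
    rw [metricTendsto_ofCompletion hT]
    exact tendsto_comap
  | ofBoundary e =>
    induction e using Quotient.inductionOn with | h ρ =>
    exact ⟨map ρ.1 atTop, inferInstance, metricTendsto_ray hT ρ⟩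

theorem setOf_near_subset_closure (hT : IsRTree T) (p x : T) : {a | Near p a x} ⊆
    @closure (HatTree T) (metricTopology T) (ofTree '' {y | SameDir p x y}) := by
  intro a ha
  let _ := metricTopology T
  obtain ⟨l, hl, h⟩ := exists_metricTendsto hT a
  exact mem_closure_of_tendsto h ((h.eventually hT ha).mono fun y hy => ⟨y, hy, rfl⟩)

theorem dense_range_ofTree (hT : IsRTree T) (a : HatTree T) :
    a ∈ @closure (HatTree T) (metricTopology T) (range ofTree) := by
  let _ := metricTopology T
  obtain ⟨l, hl, h⟩ := exists_metricTendsto hT a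
  exact mem_closure_of_tendsto h (Eventually.of_forall fun y => ⟨y, rfl⟩)

/-! ### Directions -/

theorem direction_eq_of_near (hT : IsRTree T) {p x : T} {q : HatTree T} (h : Near p q x) :
    direction (ofTree p) q = {a | Near p a x} := by
  let _ := metricTopology T
  have hq : q ∈ ({ofTree p}ᶜ : Set (HatTree T)) := by
    rintro rfl
    exact not_near_self h
  apply Subset.antisymm
  · have h2 : IsOpen (⋃ y ∈ {y : T | y ≠ p ∧ ¬ SameDir p x y}, {a : HatTree T | Near p a y}) :=
      isOpen_biUnion fun y _ => isOpen_setOf_near hT p y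
    refine isPreconnected_connectedComponentIn.subset_left_of_subset_union
      (isOpen_setOf_near hT p x) h2 ?_ ?_ ⟨q, mem_connectedComponentIn hq, h⟩
    · refine disjoint_left.2 fun a ha ha' => ?_
      obtain ⟨y, hy, hay⟩ := mem_iUnion₂.1 ha'
      exact hy.2 (Near.sameDir hT ha hay)
    · intro a ha
      by_cases hax : Near p a x
      · exact .inl hax
      · obtain ⟨y, hy⟩ := exists_near (connectedComponentIn_subset _ _ ha)
        exact .inr (mem_iUnion₂.2 ⟨y, ⟨hy.ne, fun h' => hax (hy.trans hT h'.symm)⟩, hy⟩)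
  · refine IsPreconnected.subset_connectedComponentIn ?_ h fun a ha ha' => ?_
    · refine ((hT.isPreconnected_setOf_sameDir p x).image ofTree
        (continuous_ofTree hT).continuousOn).subset_closure ?_ (setOf_near_subset_closure hT p x)
      rintro _ ⟨y, hy, rfl⟩
      exact near_ofTree.2 hy
    · rw [mem_singleton_iff.1 ha'] at ha
      exact not_near_self ha

theorem direction_eq_compl (hT : IsRTree T) {p q : HatTree T} (hp : p ∉ range ofTree)
    (hpq : q ≠ p) : direction p q = {p}ᶜ := by
  let _ := metricTopology T
  refine (connectedComponentIn_subset _ _).antisymm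
    (IsPreconnected.subset_connectedComponentIn ?_ hpq Subset.rfl)
  have := hT.preconnectedSpace
  refine (isPreconnected_range (continuous_ofTree hT)).subset_closure ?_
    fun a _ => dense_range_ofTree hT a
  rintro _ ⟨x, rfl⟩ h
  exact hp ⟨x, h⟩

theorem isOpen_setOf_near_observers (hT : IsRTree T) (p x : T) :
    IsOpen {a : HatTree T | Near p a x} := by
  rcases eq_or_ne x p with rfl | h
  · rw [eq_empty_of_forall_notMem (s := {a : HatTree T | Near x a x}) fun a ha => Near.ne ha rfl]
    exact isOpen_empty
  · exact .basic _ ⟨ofTree p, ofTree x, fun h' => h (ofTree_injective h').symm,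
      (direction_eq_of_near hT (near_ofTree.2 (SameDir.refl h))).symm⟩

/-! ### Separation -/

theorem exists_separation (hT : IsRTree T) {a b : HatTree T} (hab : a ≠ b) :
    ∃ p x y : T, Near p a x ∧ Near p b y ∧ ¬ SameDir p x y := by
  have mixed : ∀ (a : Completion T) (ρ : TreeRay T), ∃ p x y : T, Near p (ofCompletion a) x ∧
      Near p (ofBoundary (Quotient.mk (treeRaySetoid T) ρ)) y ∧ ¬ SameDir p x y := by
    intro a ρ
    obtain ⟨x, hx⟩ := exists_dist_lt a one_pos
    obtain ⟨t, ht⟩ := (TreeRay.eventually_lt_coe (dist x (ρ.1 0) + 1)).exists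
    refine ⟨ρ.1 t, x, ρ.1 (t + 1), ?_, ?_, ?_⟩
    · have h1 := ρ.sub_le_dist x t
      have h2 : 1 < dist (x : Completion T) (ρ.1 t) := by
        rw [Completion.dist_eq, dist_comm]; linarith
      show SameDir _ _ _
      unfold SameDir
      linarith [dist_nonneg (x := ((ρ.1 t : T) : Completion T)) (y := a)]
    · rw [near_mk hT]
      filter_upwards [eventually_ge_atTop (t + 1)] with s hs
      have h1 : (t : ℝ) + 1 ≤ s := by exact_mod_cast hs
      unfold SameDir
      rw [ρ.dist_eq, ρ.dist_eq, ρ.dist_eq, NNReal.coe_add, NNReal.coe_one,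
        abs_of_nonpos (by linarith), abs_of_nonneg (by linarith), abs_of_nonpos (by linarith)]
      linarith
    · rw [not_sameDir_iff]
      refine ρ.mem_treeSeg_of_lt hT ?_ (by simp)
      rw [dist_comm]; linarith
  match a, b with
  | ofCompletion a, ofCompletion b =>
    have hr : 0 < dist a b := dist_pos.2 fun h => hab (by rw [h])
    set r := dist a b with hr_def
    obtain ⟨x, hx⟩ := exists_dist_lt a (show 0 < r / 8 by linarith)
    obtain ⟨y, hy⟩ := exists_dist_lt b (show 0 < r / 8 by linarith)
    have h1 : r < dist (x : Completion T) y + r / 4 := by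
      have := dist_triangle4 a x y b
      rw [dist_comm a x] at this
      linarith
    rw [Completion.dist_eq] at h1
    obtain ⟨p, hp, hxp⟩ := hT.exists_mem_treeSeg (x := x) (y := y) (t := dist x y / 2)
      (by positivity) (by linarith [dist_nonneg (x := x) (y := y)])
    refine ⟨p, x, y, ?_, ?_, not_sameDir_iff.2 hp⟩ <;> show SameDir _ _ _ <;> unfold SameDir <;>
      rw [Completion.dist_eq]
    · have := dist_nonneg (x := (p : Completion T)) (y := a)
      linarith
    · have := dist_nonneg (x := (p : Completion T)) (y := b)
      have := mem_treeSeg.1 hp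
      rw [dist_comm y p]
      linarith
  | ofCompletion a, ofBoundary e =>
    induction e using Quotient.inductionOn with | h ρ =>
    exact mixed a ρ
  | ofBoundary e, ofCompletion a =>
    induction e using Quotient.inductionOn with | h ρ =>
    obtain ⟨p, x, y, h1, h2, h3⟩ := mixed a ρ
    exact ⟨p, y, x, h2, h1, fun h => h3 h.symm⟩
  | ofBoundary e, ofBoundary e' =>
    induction e using Quotient.inductionOn with | h ρ =>
    induction e' using Quotient.inductionOn with | h σ =>
    by_contra! hcon
    set d := dist (ρ.1 0) (σ.1 0) with hd
    have hρ : ∀ t, dist (ρ.1 0) (ρ.1 t) = t := fun t => by rw [ρ.dist_eq]; simp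
    have hσ : ∀ t, dist (σ.1 0) (σ.1 t) = t := fun t => by rw [σ.dist_eq]; simp
    refine hab (congrArg ofBoundary (Quotient.sound ⟨3 * d, fun t => ?_⟩))
    rcases le_or_gt (t : ℝ) d with ht | ht
    · have := dist_triangle4 (ρ.1 t) (ρ.1 0) (σ.1 0) (σ.1 t)
      rw [dist_comm (ρ.1 t) (ρ.1 0), hρ, hσ] at this
      linarith
    obtain ⟨x, hx⟩ := exists_near (p := ρ.1 t)
      (a := ofBoundary (Quotient.mk (treeRaySetoid T) ρ)) (by rintro ⟨⟩)
    obtain ⟨y, hy⟩ := exists_near (p := ρ.1 t)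
      (a := ofBoundary (Quotient.mk (treeRaySetoid T) σ)) (by rintro ⟨⟩)
    obtain ⟨r, ⟨h1, h2⟩, hr⟩ := ((((near_mk hT).1 hx).and ((near_mk hT).1 hy)).and
      (eventually_ge_atTop t)).exists
    have h3 : SameDir (ρ.1 t) (σ.1 r) (ρ.1 r) := (h2.symm.trans hT.fourPoint
      (hcon _ _ _ hx hy).symm).trans hT.fourPoint h1
    have h4 : ρ.1 t ∈ treeSeg (ρ.1 0) (σ.1 r) :=
      (hT.treeSeg_subset_union _ (σ.1 r) _ (ρ.mem_treeSeg (zero_le : 0 ≤ t) hr)).resolve_right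
        (notMem_treeSeg_iff.2 h3)
    have h5 : ρ.1 t ∈ treeSeg (σ.1 0) (σ.1 r) := by
      refine (hT.treeSeg_subset_union _ (σ.1 0) _ h4).resolve_left fun h => ?_
      have := IsRTree.dist_le_of_mem h
      rw [hρ] at this
      linarith
    have := hT.dist_of_mem_treeSeg h5 (σ.mem_treeSeg (zero_le : 0 ≤ t) hr)
    rw [this, hσ, abs_le]
    have e1 := dist_triangle (σ.1 0) (ρ.1 0) (ρ.1 t)
    have e2 := dist_triangle (ρ.1 0) (σ.1 0) (ρ.1 t)
    rw [dist_comm (σ.1 0) (ρ.1 0), hρ] at e1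
    rw [hρ] at e2
    have : 0 ≤ d := dist_nonneg
    constructor <;> linarith

theorem t2Space_metricTopology (hT : IsRTree T) : @T2Space (HatTree T) (metricTopology T) := by
  let _ := metricTopology T
  refine ⟨fun a b hab => ?_⟩
  obtain ⟨p, x, y, h1, h2, h3⟩ := exists_separation hT hab
  exact ⟨_, _, isOpen_setOf_near hT p x, isOpen_setOf_near hT p y, h1, h2,
    disjoint_left.2 fun c hx hy => h3 (Near.sameDir hT hx hy)⟩

theorem t2Space (hT : IsRTree T) : T2Space (HatTree T) := by
  refine ⟨fun a b hab => ?_⟩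
  obtain ⟨p, x, y, h1, h2, h3⟩ := exists_separation hT hab
  exact ⟨_, _, isOpen_setOf_near_observers hT p x, isOpen_setOf_near_observers hT p y, h1, h2,
    disjoint_left.2 fun c hx hy => h3 (Near.sameDir hT hx hy)⟩

theorem ext_of_near (hT : IsRTree T) {a b : HatTree T} (h : ∀ p x, Near p a x ↔ Near p b x) :
    a = b := by
  by_contra hab
  obtain ⟨p, x, y, h1, h2, h3⟩ := exists_separation hT hab
  exact h3 (Near.sameDir hT ((h p x).1 h1) h2)

theorem metricTopology_le (hT : IsRTree T) : metricTopology T ≤ observersTopology T := by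
  refine le_generateFrom ?_
  rintro s ⟨p, q, hpq, rfl⟩
  by_cases hp : p ∈ range ofTree
  · obtain ⟨p, rfl⟩ := hp
    obtain ⟨x, hx⟩ := exists_near hpq.symm
    rw [direction_eq_of_near hT hx]
    exact isOpen_setOf_near hT p x
  · let _ := metricTopology T
    have := t2Space_metricTopology hT
    rw [direction_eq_compl hT hp hpq.symm]
    exact isOpen_compl_singleton

end HatTree

/-! ### Sequences moving away from a point along segments -/

namespace HatTree

open UniformSpace

section Approximation

variable {T : Type u} [MetricSpace T]

/-- The points `x 0, x 1, …` lie in this order on segments issuing from `o`. -/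
def MovesAway (o : T) (x : ℕ → T) : Prop := ∀ m n, m ≤ n → x m ∈ treeSeg o (x n)

theorem exists_movesAway_completion (hT : IsRTree T) {o : T} {a : Completion T}
    (h : a ≠ (o : Completion T)) : ∃ x : ℕ → T, MovesAway o x ∧
      MetricTendsto x atTop (ofCompletion a) ∧ ∀ n, (x n : Completion T) ≠ a := by
  have hδ : 0 < dist (o : Completion T) a := dist_pos.2 h.symm
  set δ := dist (o : Completion T) a with hδ_def
  have key : ∀ r, 0 < r → r ≤ δ → ∃ q : T, dist o q = δ - r ∧ dist (q : Completion T) a = r := by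
    intro r hr hrδ
    obtain ⟨x, hx⟩ := exists_dist_lt a hr
    have hox : δ - r < dist o x := by
      rw [← Completion.dist_eq]
      linarith [dist_triangle (o : Completion T) x a]
    obtain ⟨q, hq, hoq⟩ := hT.exists_mem_treeSeg (by linarith : 0 ≤ δ - r) hox.le
    refine ⟨q, hoq, ?_⟩
    have h1 := hT.fourPoint.completion o q x a
    have h2 := dist_triangle (o : Completion T) q a
    have h3 := dist_triangle (o : Completion T) x a
    have h4 := mem_treeSeg.1 hq
    simp only [Completion.dist_eq] at h1 h2 h3
    rcases le_max_iff.1 h1 with h1 | h1 <;> linarith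
  have hr : ∀ n : ℕ, 0 < δ * (1 / ((n : ℝ) + 1)) := fun n => by positivity
  choose x hx1 hx2 using fun n : ℕ => key (δ * (1 / ((n : ℝ) + 1))) (hr n) (by
    refine mul_le_of_le_one_right hδ.le ?_
    rw [div_le_one (by positivity)]
    linarith [(Nat.cast_nonneg n : (0 : ℝ) ≤ n)])
  refine ⟨x, fun m n hmn => ?_, ?_, fun n hn => ?_⟩
  · have h1 := hT.fourPoint.completion o (x m) a (x n)
    have h2 : δ * (1 / ((n : ℝ) + 1)) ≤ δ * (1 / ((m : ℝ) + 1)) := by gcongr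
    have h3 := dist_triangle o (x m) (x n)
    rw [dist_comm a, hx2, hx2, Completion.dist_eq, Completion.dist_eq, Completion.dist_eq] at h1
    rw [mem_treeSeg]
    have e1 := hx1 m
    have e2 := hx1 n
    rcases le_max_iff.1 h1 with h1 | h1 <;> linarith
  · rw [metricTendsto_ofCompletion hT, tendsto_iff_dist_tendsto_zero]
    simp only [hx2]
    simpa using tendsto_one_div_add_atTop_nhds_zero_nat.const_mul δ
  · have := hr n
    rw [← hx2 n, hn, dist_self] at this
    exact lt_irrefl _ this

theorem exists_movesAway (hT : IsRTree T) {o : T} {a : HatTree T} (h : a ≠ ofTree o) :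
    ∃ x : ℕ → T, MovesAway o x ∧ MetricTendsto x atTop a ∧ ∀ n, ofTree (x n) ≠ a := by
  match a with
  | ofCompletion a =>
    obtain ⟨x, h1, h2, h3⟩ := exists_movesAway_completion hT fun h' : a = o => h (by rw [h', ofTree])
    exact ⟨x, h1, h2, fun n hn => h3 n (ofCompletion.inj hn)⟩
  | ofBoundary e =>
    induction e using Quotient.inductionOn with | h ρ =>
    obtain ⟨N, hN⟩ := exists_nat_gt (dist (ρ.1 0) o)
    refine ⟨fun n => ρ.1 ((n + N : ℕ) : ℝ≥0), fun m n hmn => ?_, ?_, fun n hn => ?_⟩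
    · refine ρ.mem_treeSeg_of_lt hT (hN.trans_le ?_) ?_
      · simp
      · exact_mod_cast Nat.add_le_add_right hmn N
    · exact (metricTendsto_ray hT ρ).comp
        (tendsto_natCast_atTop_atTop.comp (tendsto_add_atTop_nat N))
    · cases hn

theorem MovesAway.dist_eq (hT : IsRTree T) {o : T} {x : ℕ → T} (hx : MovesAway o x) (m n : ℕ) :
    dist (x m) (x n) = |dist o (x m) - dist o (x n)| :=
  hT.dist_of_mem_treeSeg (hx m _ (le_max_left m n)) (hx n _ (le_max_right m n))

theorem MovesAway.monotone_dist {o : T} {x : ℕ → T} (hx : MovesAway o x) :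
    Monotone fun n => dist o (x n) :=
  fun m n hmn => IsRTree.dist_le_of_mem (hx m n hmn)

theorem MovesAway.mem_treeSeg_of_tendsto {o p : T} {x : ℕ → T} (hx : MovesAway o x)
    (h : Tendsto x atTop (𝓝 p)) (m : ℕ) : x m ∈ treeSeg o p := by
  have hc : IsClosed {z | x m ∈ treeSeg o z} := isClosed_eq (by fun_prop) (by fun_prop)
  exact hc.mem_of_tendsto h ((eventually_ge_atTop m).mono fun n hn => hx m n hn)

theorem MovesAway.exists_ray (hT : IsRTree T) {o : T} {x : ℕ → T} (hx : MovesAway o x)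
    (hu : ∀ t : ℝ, ∃ n, t ≤ dist o (x n)) :
    ∃ ρ : TreeRay T, ∀ n, ρ.1 ⟨dist o (x n), dist_nonneg⟩ = x n := by
  choose N hN using fun t : ℝ≥0 => hu t
  choose ρ hρ hρd using fun t : ℝ≥0 => hT.exists_mem_treeSeg (NNReal.coe_nonneg t) (hN t)
  have key : ∀ (t : ℝ≥0) (n : ℕ), (t : ℝ) ≤ dist o (x n) → ρ t ∈ treeSeg o (x n) := by
    intro t n htn
    rcases le_total (N t) n with h | h
    · exact mem_treeSeg_trans (hx _ _ h) (hρ t)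
    · exact hT.mem_treeSeg_of_dist_le (hρ t) (hx _ _ h) (by rw [hρd]; exact htn)
  refine ⟨⟨ρ, Isometry.of_dist_eq fun s t => ?_⟩, fun n => ?_⟩
  · have h1 := key s _ ((hN s).trans (hx.monotone_dist (le_max_left (N s) (N t))))
    have h2 := key t _ ((hN t).trans (hx.monotone_dist (le_max_right (N s) (N t))))
    rw [hT.dist_of_mem_treeSeg h1 h2, hρd, hρd, NNReal.dist_eq]
  · exact hT.eq_of_mem_treeSeg (key _ n le_rfl) (right_mem_treeSeg o (x n)) (hρd _)

theorem MovesAway.exists_limit (hT : IsRTree T) {o : T} {x : ℕ → T} (hx : MovesAway o x) :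
    ∃ a, MetricTendsto x atTop a := by
  by_cases hb : BddAbove (range fun n => dist o (x n))
  · have h1 := (tendsto_atTop_ciSup hx.monotone_dist hb).cauchySeq
    have h2 : CauchySeq x := by
      rw [Metric.cauchySeq_iff] at h1 ⊢
      intro ε hε
      obtain ⟨N, hN⟩ := h1 ε hε
      refine ⟨N, fun m hm n hn => ?_⟩
      rw [hx.dist_eq hT]
      exact hN m hm n hn
    obtain ⟨a, ha⟩ := cauchySeq_tendsto_of_complete (u := fun n => (x n : Completion T))
      (h2.map (Completion.uniformContinuous_coe T))
    exact ⟨ofCompletion a, (metricTendsto_ofCompletion hT).2 ha⟩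
  · have hu : ∀ t : ℝ, ∃ n, t ≤ dist o (x n) := by
      intro t
      by_contra! h
      exact hb ⟨t, by rintro _ ⟨n, rfl⟩; exact (h n).le⟩
    obtain ⟨ρ, hρ⟩ := hx.exists_ray hT hu
    refine ⟨_, ((metricTendsto_ray hT ρ).comp (g := fun t => ofTree (ρ.1 t))
      (f := fun n => (⟨dist o (x n), dist_nonneg⟩ : ℝ≥0)) ?_).congr fun n => by
        simp only [Function.comp_apply, hρ n]⟩
    exact NNReal.tendsto_coe_atTop.1 (tendsto_atTop_atTop_of_monotone hx.monotone_dist hu)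

/-- The closures of a connected subset of `T` in `T̂` for the two topologies agree. -/
theorem closure_metricTopology_eq (hT : IsRTree T) {S : Set T} (hS : IsPreconnected S) :
    @closure (HatTree T) (metricTopology T) (ofTree '' S) = closure (ofTree '' S) := by
  apply Subset.antisymm
  · exact closure.mono (metricTopology_le hT)
  intro a ha
  obtain ⟨_, -, ⟨o, ho, rfl⟩⟩ := mem_closure_iff.1 ha univ isOpen_univ trivial
  let _ := metricTopology T
  rcases eq_or_ne a (ofTree o) with rfl | hao
  · exact subset_closure ⟨o, ho, rfl⟩
  obtain ⟨x, hx, hxa, hne⟩ := exists_movesAway hT hao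
  refine mem_closure_of_tendsto hxa (Eventually.of_forall fun n => ⟨x n, ?_, rfl⟩)
  by_contra hn
  obtain ⟨y, hy⟩ := exists_near (hne n).symm
  obtain ⟨_, hs, ⟨s, hsS, rfl⟩⟩ :=
    (@mem_closure_iff _ (observersTopology T) _ _).1 ha _ (isOpen_setOf_near_observers hT (x n) y) hy
  have hos : SameDir (x n) y o := by
    have := hS.subset_left_of_subset_union (isOpen_setOf_sameDir (x n) y)
      (isOpen_setOf_not_sameDir hT.fourPoint (x n) y)
      (disjoint_left.2 fun z h h' => h'.2 h) (fun z hz => ?_) ⟨s, hsS, (near_ofTree.1 hs : SameDir (x n) y s)⟩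
    · exact this ho
    · by_cases h : SameDir (x n) y z
      · exact .inl h
      · exact .inr ⟨fun h' => hn (h' ▸ hz), h⟩
  obtain ⟨m, h1, h2⟩ := ((hxa.eventually hT hy).and (eventually_ge_atTop n)).exists
  exact notMem_treeSeg_iff.2 (hos.symm.trans hT.fourPoint h1) (hx n m h2)

end Approximation

/-! ### Extension of segment preserving bijections -/

section Extension

variable {T : Type u} {T' : Type v} [MetricSpace T] [MetricSpace T']

/-- A bijection that, together with its inverse, preserves segments and is continuous on them. -/
structure IsSegmentIso (e : T ≃ T') : Prop where
  mem_treeSeg : ∀ x y z, e z ∈ treeSeg (e x) (e y) ↔ z ∈ treeSeg x y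
  continuousOn : ContinuousOnSegments e
  continuousOn_symm : ContinuousOnSegments e.symm

theorem IsSegmentIso.of_bijective (hT : IsRTree T) (hT' : IsRTree T') (e : T ≃ T')
    (he : ContinuousOnSegments e) : IsSegmentIso e := by
  have him : ∀ x y, e '' treeSeg x y = treeSeg (e x) (e y) := by
    intro x y
    rcases eq_or_ne x y with rfl | hxy
    · rw [treeSeg_self, treeSeg_self, image_singleton]
    obtain ⟨γ, hγ, hinj, h1, h2, -⟩ := hT.exists_geodesic_treeSeg x y
    have := hT'.image_Icc_eq_treeSeg (dist_pos.2 hxy) (q := e ∘ γ)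
      ((he x y).comp hγ.continuousOn fun t ht => (h2 t ht).1) (e.injective.comp_injOn hinj)
    have h0 : γ 0 = x := by simpa using h1 x (left_mem_treeSeg x y)
    have hd : γ (dist x y) = y := h1 y (right_mem_treeSeg x y)
    rw [Function.comp_apply, Function.comp_apply, h0, hd, image_comp,
      IsRTree.image_geodesic h1 h2] at this
    exact this
  refine ⟨fun x y z => ?_, he, fun x y => ?_⟩
  · rw [← him, e.injective.mem_set_image]
  · obtain ⟨x, rfl⟩ := e.surjective x
    obtain ⟨y, rfl⟩ := e.surjective y
    rw [← him]
    have : CompactSpace (treeSeg x y) := isCompact_iff_compactSpace.1 (hT.isCompact_treeSeg x y)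
    have hemb : IsEmbedding ((treeSeg x y).domRestrict e) :=
      ((he x y).domRestrict.isClosedEmbedding e.injective.injOn.injective).isEmbedding
    rw [← range_domRestrict, ← image_univ, hemb.isInducing.continuousOn_image_iff]
    refine continuous_subtype_val.continuousOn.congr fun z _ => ?_
    simp

theorem IsSegmentIso.symm {e : T ≃ T'} (he : IsSegmentIso e) : IsSegmentIso e.symm where
  mem_treeSeg x y z := by rw [← he.mem_treeSeg]; simp
  continuousOn := he.continuousOn_symm
  continuousOn_symm := he.continuousOn

theorem IsSegmentIso.sameDir {e : T ≃ T'} (he : IsSegmentIso e) {p x y : T} :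
    SameDir (e p) (e x) (e y) ↔ SameDir p x y := by
  rw [← notMem_treeSeg_iff, ← notMem_treeSeg_iff, he.mem_treeSeg]

theorem IsSegmentIso.movesAway {e : T ≃ T'} (he : IsSegmentIso e) {o : T} {x : ℕ → T}
    (hx : MovesAway o x) : MovesAway (e o) (e ∘ x) :=
  fun m n hmn => (he.mem_treeSeg _ _ _).2 (hx m n hmn)

theorem IsSegmentIso.tendsto {e : T ≃ T'} (he : IsSegmentIso e) {o p : T} {x : ℕ → T}
    (hx : MovesAway o x) (h : Tendsto x atTop (𝓝 p)) : Tendsto (e ∘ x) atTop (𝓝 (e p)) :=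
  (he.continuousOn o p p (right_mem_treeSeg o p)).tendsto.comp
    (tendsto_nhdsWithin_iff.2 ⟨h, Eventually.of_forall (hx.mem_treeSeg_of_tendsto h)⟩)

theorem MetricTendsto.unique (hT : IsRTree T) {ι : Type*} {l : Filter ι} [l.NeBot] {x : ι → T}
    {a b : HatTree T} (ha : MetricTendsto x l a) (hb : MetricTendsto x l b) : a = b := by
  let _ := metricTopology T
  have := t2Space_metricTopology hT
  exact tendsto_nhds_unique ha hb

theorem IsSegmentIso.near_of_near (hT : IsRTree T) (hT' : IsRTree T') {e : T ≃ T'}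
    (he : IsSegmentIso e) {o : T} {x : ℕ → T} (hx : MovesAway o x) {a : HatTree T}
    {a' : HatTree T'} (ha : MetricTendsto x atTop a) (ha' : MetricTendsto (e ∘ x) atTop a')
    {p y : T} (h : Near p a y) : Near (e p) a' (e y) := by
  rcases eq_or_ne a' (ofTree (e p)) with rfl | hne
  · have h1 := he.symm.tendsto (he.movesAway hx) ((metricTendsto_ofTree hT').1 ha')
    have h2 : Tendsto x atTop (𝓝 p) := by simpa [Function.comp_def] using h1
    rw [ha.unique hT ((metricTendsto_ofTree hT).2 h2)] at h
    exact absurd h not_near_self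
  · obtain ⟨z, hz⟩ := exists_near hne
    obtain ⟨n, h1, h2⟩ := ((ha.eventually hT h).and (ha'.eventually hT' hz)).exists
    exact hz.trans hT' (h2.trans hT'.fourPoint (he.sameDir.2 h1).symm)

theorem IsSegmentIso.exists_corresponding (hT : IsRTree T) (hT' : IsRTree T') {e : T ≃ T'}
    (he : IsSegmentIso e) (a : HatTree T) :
    ∃ a' : HatTree T', ∀ p y, Near (e p) a' (e y) ↔ Near p a y := by
  by_cases ha : ∃ x, a = ofTree x
  · obtain ⟨x, rfl⟩ := ha
    exact ⟨ofTree (e x), fun p y => by rw [near_ofTree, near_ofTree, he.sameDir]⟩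
  · obtain ⟨l, hl, -⟩ := exists_metricTendsto hT a
    obtain ⟨o⟩ : Nonempty T := l.nonempty_of_neBot
    obtain ⟨x, hx, hxa, -⟩ := exists_movesAway hT fun h : a = ofTree o => ha ⟨o, h⟩
    obtain ⟨a', ha'⟩ := (he.movesAway hx).exists_limit hT'
    refine ⟨a', fun p y => ⟨fun h => ?_, he.near_of_near hT hT' hx hxa ha'⟩⟩
    have := he.symm.near_of_near hT' hT (he.movesAway hx) ha'
      (by simpa [Function.comp_def] using hxa) h
    simpa using this

theorem IsSegmentIso.exists_equiv (hT : IsRTree T) (hT' : IsRTree T') {e : T ≃ T'}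
    (he : IsSegmentIso e) : ∃ F : HatTree T ≃ HatTree T',
      ∀ a p y, Near (e p) (F a) (e y) ↔ Near p a y := by
  choose F hF using he.exists_corresponding hT hT'
  choose G hG using he.symm.exists_corresponding hT' hT
  refine ⟨⟨F, G, fun a => ext_of_near hT fun p y => ?_, fun a => ext_of_near hT' fun p y => ?_⟩, hF⟩
  · have := hG (F a) (e p) (e y)
    rw [e.symm_apply_apply, e.symm_apply_apply] at this
    rw [this, hF]
  · have := hF (G a) (e.symm p) (e.symm y)
    rw [e.apply_symm_apply, e.apply_symm_apply] at this
    rw [this, hG]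

theorem continuous_of_near_iff (hT : IsRTree T) (hT' : IsRTree T') {e : T ≃ T'}
    {F : HatTree T ≃ HatTree T'} (hF : ∀ a p y, Near (e p) (F a) (e y) ↔ Near p a y) : Continuous F := by
  refine continuous_generateFrom_iff.2 ?_
  rintro s ⟨p, q, hpq, rfl⟩
  by_cases hp : p ∈ range ofTree
  · obtain ⟨p, rfl⟩ := hp
    obtain ⟨y, hy⟩ := exists_near hpq.symm
    rw [direction_eq_of_near hT' hy]
    obtain ⟨p, rfl⟩ := e.surjective p
    obtain ⟨y, rfl⟩ := e.surjective y
    convert isOpen_setOf_near_observers hT p y using 1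
    ext a
    exact hF a p y
  · have := t2Space hT
    rw [direction_eq_compl hT' hp hpq.symm, preimage_compl, isOpen_compl_iff]
    exact (subsingleton_singleton.preimage F.injective).isClosed

theorem IsSegmentIso.exists_homeomorph (hT : IsRTree T) (hT' : IsRTree T') {e : T ≃ T'}
    (he : IsSegmentIso e) :
    ∃ F : HatTree T ≃ₜ HatTree T', ∀ x, F (ofTree x) = ofTree (e x) := by
  obtain ⟨F, hF⟩ := he.exists_equiv hT hT'
  have hFe : ∀ x, F (ofTree x) = ofTree (e x) := by
    intro x
    refine ext_of_near hT' fun p y => ?_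
    obtain ⟨p, rfl⟩ := e.surjective p
    obtain ⟨y, rfl⟩ := e.surjective y
    rw [hF, near_ofTree, near_ofTree, he.sameDir]
  refine ⟨⟨F, continuous_of_near_iff hT hT' hF,
    continuous_of_near_iff hT' hT (e := e.symm) (F := F.symm) fun a p y => ?_⟩, hFe⟩
  rw [← hF]
  simp

theorem denseRange_ofTree (hT : IsRTree T) : DenseRange (ofTree : T → HatTree T) :=
  fun a => closure.mono (metricTopology_le hT) (dense_range_ofTree hT a)

end Extension

end HatTree

/-! ### Dual laminations -/

namespace OuterSpaceTree

variable {n : ℕ}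

/-- The tree `T₀` with the edge lengths induced by an equivariant map to `T`. -/
def induceLength (T₀ : OuterSpaceTree n) {T : Type u} [MetricSpace T]
    [MulAction (FreeGroup (Fin n)) T]
    (hT : ∀ (g : FreeGroup (Fin n)) (x y : T), dist (g • x) (g • y) = dist x y)
    (φ : T₀.V → T) (hφ : ∀ (g : FreeGroup (Fin n)) (a : T₀.V), φ (g • a) = g • φ a)
    (hne : ∀ a b, T₀.graph.Adj a b → φ a ≠ φ b) : OuterSpaceTree n :=
  { T₀ with
    len := fun a b => dist (φ a) (φ b)
    len_pos := fun a b h => dist_pos.2 (hne a b h)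
    len_comm := fun _ _ => dist_comm _ _
    len_smul := fun g a b => by rw [hφ, hφ, hT] }

theorem EdgeIsometry.isPreconnected_rayImage {T₀ : OuterSpaceTree n} {T : Type u} [MetricSpace T]
    [MulAction (FreeGroup (Fin n)) T] (hT : IsRTree T) (φ : T₀.EdgeIsometry T) (ρ : ℕ → T₀.V) :
    IsPreconnected (φ.rayImage ρ) :=
  IsPreconnected.iUnion_of_chain (fun _ => hT.isPreconnected_treeSeg _ _) fun _ =>
    ⟨_, right_mem_treeSeg _ _, left_mem_treeSeg _ _⟩

end OuterSpaceTree

open HatTree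

section Lamination

variable {n : ℕ} {T : Type u} {T' : Type v} [MetricSpace T] [MetricSpace T']
  [MulAction (FreeGroup (Fin n)) T] [MulAction (FreeGroup (Fin n)) T']

theorem IsQCandidate.map (hT : IsRTree T) (hT' : IsRTree T')
    (hisom : ∀ (g : FreeGroup (Fin n)) (x y : T), dist (g • x) (g • y) = dist x y)
    {e : T ≃ T'} (he : IsSegmentIso e)
    (hequiv : ∀ (g : FreeGroup (Fin n)) (x : T), e (g • x) = g • e x)
    {F : HatTree T ≃ₜ HatTree T'} (hF : ∀ x, F (ofTree x) = ofTree (e x))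
    {X : FreeBoundary n} {P : HatTree T} (hP : IsQCandidate X P) : IsQCandidate X (F P) := by
  intro T₀ φ ρ hρ hX
  have hφ : ∀ (g : FreeGroup (Fin n)) (a : T₀.V),
      e.symm (φ.toFun (g • a)) = g • e.symm (φ.toFun a) := by
    intro g a
    rw [Equiv.symm_apply_eq, hequiv, e.apply_symm_apply, φ.map_smul]
  have hne : ∀ a b, T₀.graph.Adj a b → e.symm (φ.toFun a) ≠ e.symm (φ.toFun b) := by
    intro a b hab h
    have := T₀.len_pos a b hab
    rw [← φ.dist_eq a b hab, e.symm.injective h, dist_self] at this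
    exact lt_irrefl _ this
  let T₁ := T₀.induceLength hisom (fun a => e.symm (φ.toFun a)) hφ hne
  let ψ : T₁.EdgeIsometry T := ⟨fun a => e.symm (φ.toFun a), hφ, fun _ _ _ => rfl⟩
  have himage : e '' ψ.rayImage ρ = φ.rayImage ρ := by
    ext z
    obtain ⟨z, rfl⟩ := e.surjective z
    simp only [e.injective.mem_set_image, OuterSpaceTree.EdgeIsometry.rayImage, mem_iUnion, ψ]
    refine exists_congr fun i => ?_
    rw [← he.mem_treeSeg, e.apply_symm_apply, e.apply_symm_apply]
  have h := hP T₁ ψ ρ hρ hX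
  rw [closure_metricTopology_eq hT (ψ.isPreconnected_rayImage hT ρ)] at h
  rw [closure_metricTopology_eq hT' (φ.isPreconnected_rayImage hT' ρ), ← himage]
  have h' := mem_image_of_mem F h
  rw [F.image_closure, image_image] at h'
  simpa only [hF, image_image] using h'

theorem IsQ.map (hT : IsRTree T) (hT' : IsRTree T')
    (hisom : ∀ (g : FreeGroup (Fin n)) (x y : T), dist (g • x) (g • y) = dist x y)
    (hisom' : ∀ (g : FreeGroup (Fin n)) (x y : T'), dist (g • x) (g • y) = dist x y)
    {e : T ≃ T'} (he : IsSegmentIso e)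
    (hequiv : ∀ (g : FreeGroup (Fin n)) (x : T), e (g • x) = g • e x)
    {F : HatTree T ≃ₜ HatTree T'} (hF : ∀ x, F (ofTree x) = ofTree (e x))
    {X : FreeBoundary n} {P : HatTree T} (hP : IsQ X P) : IsQ X (F P) := by
  refine ⟨hP.1.map hT hT' hisom he hequiv hF, fun P' hP' => ?_⟩
  have h := hP.2 (F.symm P') (hP'.map hT' hT hisom' he.symm (fun g x => ?_) (fun x => ?_))
  · rw [← h, F.apply_symm_apply]
  · rw [Equiv.symm_apply_eq, hequiv, e.apply_symm_apply]
  · rw [F.symm_apply_eq, hF, e.apply_symm_apply]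

theorem dualLamination_subset (hT : IsRTree T) (hT' : IsRTree T')
    (hisom : ∀ (g : FreeGroup (Fin n)) (x y : T), dist (g • x) (g • y) = dist x y)
    (hisom' : ∀ (g : FreeGroup (Fin n)) (x y : T'), dist (g • x) (g • y) = dist x y)
    {e : T ≃ T'} (he : IsSegmentIso e)
    (hequiv : ∀ (g : FreeGroup (Fin n)) (x : T), e (g • x) = g • e x) :
    dualLamination n T ⊆ dualLamination n T' := by
  obtain ⟨F, hF⟩ := he.exists_homeomorph hT hT'
  rintro ⟨X, Y⟩ ⟨hne, P, hX, hY⟩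
  exact ⟨hne, F P, hX.map hT hT' hisom hisom' he hequiv hF, hY.map hT hT' hisom hisom' he hequiv hF⟩

end Lamination

theorem lemmaL (n : ℕ)
    (T : Type u) [MetricSpace T] [MulAction (FreeGroup (Fin n)) T]
    (T' : Type v) [MetricSpace T'] [MulAction (FreeGroup (Fin n)) T']
    (hT : IsClosedOuterSpaceTree n T) (hT' : IsClosedOuterSpaceTree n T')
    (hd : HasDenseOrbits (FreeGroup (Fin n)) T) (hd' : HasDenseOrbits (FreeGroup (Fin n)) T')
    (f : T → T') (hf_equiv : ∀ (g : FreeGroup (Fin n)) (x : T), f (g • x) = g • f x)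
    (hf_bij : Function.Bijective f) (hf_cont : ContinuousOnSegments f) :
    (∃! F : HatTree T ≃ₜ HatTree T', ∀ x : T, F (HatTree.ofTree x) = HatTree.ofTree (f x)) ∧
      dualLamination n T = dualLamination n T' := by
  let e : T ≃ T' := Equiv.ofBijective f hf_bij
  have he : IsSegmentIso e := .of_bijective hT.isRTree hT'.isRTree e hf_cont
  have hequiv : ∀ (g : FreeGroup (Fin n)) (x : T), e (g • x) = g • e x := hf_equiv
  have hequiv' : ∀ (g : FreeGroup (Fin n)) (x : T'), e.symm (g • x) = g • e.symm x := fun g x => by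
    rw [Equiv.symm_apply_eq, hequiv, e.apply_symm_apply]
  constructor
  · obtain ⟨F, hF⟩ := he.exists_homeomorph hT.isRTree hT'.isRTree
    refine ⟨F, hF, fun F' hF' => ?_⟩
    have := t2Space hT'.isRTree
    refine Homeomorph.ext fun a => congrFun ?_ a
    refine (denseRange_ofTree hT.isRTree).equalizer F'.continuous F.continuous (funext fun x => ?_)
    exact (hF' x).trans (hF x).symm
  · exact (dualLamination_subset hT.isRTree hT'.isRTree hT.isometric hT'.isometric he hequiv).antisymm
      (dualLamination_subset hT'.isRTree hT.isRTree hT'.isometric hT.isometric he.symm hequiv')
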